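/- Let $G$ be a countable abelian group acting on a probability space $(X,\mathcal B,\mu)$ by measure preserving maps, that is, for each $g\in G$ the map $x\mapsto g.x$ is measurable and preserves $\mu$. For $A\subset G$ and $B'\subset X$ write $AB'=\{a.x : a\in A,\ x\in B'\}$, and for $A\subset G$ and $B\in\mathcal B$ with $\mu(B)>0$ define the magnification ratio $$c(A,B)=\inf\left\{\frac{\mu(AB')}{\mu(B')} \;:\; B'\subset B,\ B'\in\mathcal B,\ \mu(B')>0\right\}.$$ Then for every $k$, all (not necessarily finite) sets $A_1,\dots,A_k\subset G$ and every $B\in\mathcal B$ with $\mu(B)>0$, $$c(A_1A_2\cdots A_k,\,B)\;\le\;\prod_{i=1}^k\frac{\mu(A_iB)}{\mu(B)},$$ where $A_1A_2\cdots A_k=\{a_1a_2\cdots a_k : a_i\in A_i\}$. -/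

import Mathlib

open MeasureTheory
open scoped Pointwise ENNReal

/-- The magnification ratio of a set `A` of translates on the set `B`: the infimum of
`μ (A B') / μ (B')` over all measurable `B' ⊆ B` of positive measure, where
`A B' = {a • x | a ∈ A, x ∈ B'}`. -/
noncomputable def magnificationRatio {G X : Type*} [SMul G X] [MeasurableSpace X]
    (μ : Measure X) (A : Set G) (B : Set X) : ℝ≥0∞ :=
  sInf {r : ℝ≥0∞ | ∃ B' : Set X, B' ⊆ B ∧ MeasurableSet B' ∧ 0 < μ B' ∧ r = μ (A • B') / μ B'}

/-! ### Minimizers of submodular set functions. -/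

open Filter Topology

/-! Petridis' method gives the inequality up to a constant, and tensor powers remove it. Minimizing
a weighted sum of `μ.real (A i • S)` minus `l * μ.real S` over `S ⊆ B` yields one `Y` whose
expansion bounds persist for every `C • Y` (`exists_subset_sum_measureReal_smul_le`). Applying the
`A i` one after another then costs a factor depending only on the number of sets. Lower bounds for
expansion multiply on products (`mul_measure_le_measure_prod_smul`), so repeated squaring of the
system leaves that factor fixed while both sides are raised to the power `2 ^ n`. -/

/-- A submodular set function that is continuous from below has a minimizer after subtracting a
multiple of a finite measure. -/
theorem exists_minimizer_of_submodular {X : Type*} [MeasurableSpace X] (μ : Measure X)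
    [IsFiniteMeasure μ] (φ : Set X → ℝ) (hpos : ∀ S, 0 ≤ φ S) (hmono : Monotone φ)
    (hsub : ∀ S T, MeasurableSet S → MeasurableSet T → φ (S ∪ T) + φ (S ∩ T) ≤ φ S + φ T)
    (hcont : ∀ s : ℕ → Set X, Monotone s → (∀ n, MeasurableSet (s n)) →
      Tendsto (fun n => φ (s n)) atTop (𝓝 (φ (⋃ n, s n))))
    (l : ℝ) (hl : 0 ≤ l) (B : Set X) :
    ∃ Y ⊆ B, MeasurableSet Y ∧
      ∀ Z ⊆ B, MeasurableSet Z → φ Y - l * μ.real Y ≤ φ Z - l * μ.real Z := by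
  set F : Set X → ℝ := fun S => φ S - l * μ.real S with hF
  set R : Set ℝ := F '' {S | S ⊆ B ∧ MeasurableSet S} with hR
  have hne : R.Nonempty := ⟨F ∅, ∅, ⟨Set.empty_subset _, MeasurableSet.empty⟩, rfl⟩
  have hbdd : BddBelow R := by
    refine ⟨-(l * μ.real Set.univ), ?_⟩
    rintro _ ⟨S, -, rfl⟩
    have h1 := hpos S
    have h2 : l * μ.real S ≤ l * μ.real Set.univ :=
      mul_le_mul_of_nonneg_left (measureReal_mono (Set.subset_univ S)) hl
    simp only [hF]
    linarith
  set m := sInf R with hm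
  have hmle : ∀ S ⊆ B, MeasurableSet S → m ≤ F S := fun S h1 h2 =>
    csInf_le hbdd ⟨S, ⟨h1, h2⟩, rfl⟩
  have hseq : ∀ n : ℕ, ∃ S ⊆ B, MeasurableSet S ∧ F S < m + (1 / 2) ^ n := by
    intro n
    obtain ⟨_, ⟨S, ⟨h1, h2⟩, rfl⟩, h3⟩ :=
      exists_lt_of_csInf_lt hne (show sInf R < m + (1 / 2) ^ n by
        rw [← hm]; exact lt_add_of_pos_right _ (by positivity))
    exact ⟨S, h1, h2, h3⟩
  choose s hsB hsm hs using hseq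
  have hFsub : ∀ S T, MeasurableSet S → MeasurableSet T → F (S ∪ T) + F (S ∩ T) ≤ F S + F T := by
    intro S T hS hT
    have h1 := hsub S T hS hT
    have h2 : μ.real (S ∪ T) + μ.real (S ∩ T) = μ.real S + μ.real T :=
      measureReal_union_add_inter hT
    have h3 : l * μ.real (S ∪ T) + l * μ.real (S ∩ T) = l * μ.real S + l * μ.real T := by
      rw [← mul_add, h2, mul_add]
    simp only [hF]
    linarith
  have haccB : ∀ n j, Set.accumulate (fun i => s (n + i)) j ⊆ B := fun n j =>
    Set.iUnion₂_subset fun i _ => hsB _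
  have haccm : ∀ n j, MeasurableSet (Set.accumulate (fun i => s (n + i)) j) := fun n j =>
    MeasurableSet.biUnion (Set.to_countable _) fun i _ => hsm _
  -- The intersection in submodularity has `F ≥ m`, so each new set adds at most its own excess; the
  -- bound is the partial geometric sum.
  have hacc : ∀ n j, F (Set.accumulate (fun i => s (n + i)) j) ≤
      m + 2 * (1 / 2) ^ n - (1 / 2) ^ (n + j) := by
    intro n j
    induction j with
    | zero =>
      have := hs n
      simp only [Set.accumulate_zero_nat, add_zero]
      linarith
    | succ j ih =>
      rw [Set.accumulate_succ]
      have h1 := hFsub _ _ (haccm n j) (hsm (n + (j + 1)))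
      have h2 := hmle (Set.accumulate (fun i => s (n + i)) j ∩ s (n + (j + 1)))
        (Set.inter_subset_right.trans (hsB _)) ((haccm n j).inter (hsm _))
      have h3 := hs (n + (j + 1))
      have h4 : ((1 : ℝ) / 2) ^ (n + j) = 2 * (1 / 2) ^ (n + (j + 1)) := by
        rw [← add_assoc, pow_succ]; ring
      linarith
  set V : ℕ → Set X := fun n => ⋃ i, s (n + i) with hV
  have hVm : ∀ n, MeasurableSet (V n) := fun n => MeasurableSet.iUnion fun i => hsm _
  have hVB : ∀ n, V n ⊆ B := fun n => Set.iUnion_subset fun i => hsB _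
  have hVF : ∀ n, F (V n) ≤ m + 2 * (1 / 2) ^ n := by
    intro n
    have hmon : Monotone (Set.accumulate fun i => s (n + i)) := Set.monotone_accumulate
    have hU : (⋃ j, Set.accumulate (fun i => s (n + i)) j) = V n := Set.iUnion_accumulate
    have t1 := hcont _ hmon (haccm n)
    have t2 : Tendsto (fun j => μ.real (Set.accumulate (fun i => s (n + i)) j)) atTop
        (𝓝 (μ.real (⋃ j, Set.accumulate (fun i => s (n + i)) j))) :=
      (ENNReal.tendsto_toReal (measure_ne_top _ _)).comp (tendsto_measure_iUnion_atTop hmon)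
    rw [hU] at t1 t2
    refine le_of_tendsto' (t1.sub (t2.const_mul l)) fun j => ?_
    have h1 := hacc n j
    have h2 : (0 : ℝ) < (1 / 2) ^ (n + j) := by positivity
    simp only [hF] at h1
    linarith
  have hVanti : Antitone V := by
    refine antitone_nat_of_succ_le fun n => Set.iUnion_subset fun i => ?_
    rw [show n + 1 + i = n + (i + 1) by ring]
    exact Set.subset_iUnion (fun i => s (n + i)) (i + 1)
  refine ⟨⋂ n, V n, (Set.iInter_subset V 0).trans (hVB 0), MeasurableSet.iInter hVm, ?_⟩
  intro Z hZB hZ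
  refine le_trans ?_ (hmle Z hZB hZ)
  have t1 : Tendsto (fun n => μ.real (V n)) atTop (𝓝 (μ.real (⋂ n, V n))) :=
    (ENNReal.tendsto_toReal (measure_ne_top _ _)).comp
      (tendsto_measure_iInter_atTop (fun n => (hVm n).nullMeasurableSet) hVanti
        ⟨0, measure_ne_top _ _⟩)
  have t2 : Tendsto (fun n : ℕ => m + 2 * ((1 : ℝ) / 2) ^ n + l * μ.real (V n)) atTop
      (𝓝 (m + 2 * 0 + l * μ.real (⋂ n, V n))) :=
    (((tendsto_pow_atTop_nhds_zero_of_lt_one (by norm_num) (by norm_num)).const_mul 2).const_add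
      m).add (t1.const_mul l)
  -- Monotonicity of `φ` replaces continuity from above, which is not assumed.
  have h : φ (⋂ n, V n) ≤ m + 2 * 0 + l * μ.real (⋂ n, V n) := by
    refine ge_of_tendsto' t2 fun n => ?_
    have h1 := hVF n
    have h2 : φ (⋂ n, V n) ≤ φ (V n) := hmono (Set.iInter_subset V n)
    simp only [hF] at h1
    linarith
  linarith

/-! ### Petridis' lemma for group actions. -/

section Translates

variable {G X : Type*} [CommGroup G] [MulAction G X] [MeasurableSpace X]
  {μ : Measure X}

theorem measurableSet_smul_set_of_measurePreserving
    (hact : ∀ g : G, MeasurePreserving (fun x : X => g • x) μ μ) (g : G) {S : Set X}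
    (hS : MeasurableSet S) : MeasurableSet (g • S) := by
  rw [← Set.preimage_smul_inv]
  exact (hact g⁻¹).measurable hS

theorem measure_smul_set_of_measurePreserving
    (hact : ∀ g : G, MeasurePreserving (fun x : X => g • x) μ μ) (g : G) {S : Set X}
    (hS : MeasurableSet S) : μ (g • S) = μ S := by
  rw [← Set.preimage_smul_inv]
  exact (hact g⁻¹).measure_preimage hS.nullMeasurableSet

theorem tendsto_measureReal_set_smul_iUnion [IsFiniteMeasure μ] (A : Set G) {s : ℕ → Set X}
    (hs : Monotone s) :
    Tendsto (fun n => μ.real (A • s n)) atTop (𝓝 (μ.real (A • ⋃ n, s n))) := by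
  rw [Set.smul_iUnion]
  exact (ENNReal.tendsto_toReal (measure_ne_top _ _)).comp
    (tendsto_measure_iUnion_atTop fun i j h => Set.smul_subset_smul_left (hs h))

variable [Countable G]

theorem measurableSet_set_smul_of_measurePreserving
    (hact : ∀ g : G, MeasurePreserving (fun x : X => g • x) μ μ) (A : Set G) {S : Set X}
    (hS : MeasurableSet S) : MeasurableSet (A • S) := by
  rw [← Set.iUnion_smul_set]
  exact MeasurableSet.biUnion A.to_countable fun g _ =>
    measurableSet_smul_set_of_measurePreserving hact g hS

/-- Commutativity of `G` lets `g` move past `A`. -/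
theorem measureReal_set_smul_smul_set
    (hact : ∀ g : G, MeasurePreserving (fun x : X => g • x) μ μ) (A : Set G) (g : G) {S : Set X}
    (hS : MeasurableSet S) : μ.real (A • g • S) = μ.real (A • S) := by
  rw [smul_comm A g S, measureReal_def,
    measure_smul_set_of_measurePreserving hact g
      (measurableSet_set_smul_of_measurePreserving hact A hS), measureReal_def]

variable [IsFiniteMeasure μ]

theorem measureReal_set_smul_submodular
    (hact : ∀ g : G, MeasurePreserving (fun x : X => g • x) μ μ) (A : Set G) {S T : Set X}
    (hT : MeasurableSet T) :
    μ.real (A • (S ∪ T)) + μ.real (A • (S ∩ T)) ≤ μ.real (A • S) + μ.real (A • T) := by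
  rw [Set.smul_union, ← measureReal_union_add_inter
    (measurableSet_set_smul_of_measurePreserving hact A hT)]
  have h : A • (S ∩ T) ⊆ A • S ∩ A • T :=
    Set.subset_inter (Set.smul_subset_smul_left Set.inter_subset_left)
      (Set.smul_subset_smul_left Set.inter_subset_right)
  linarith [measureReal_mono (μ := μ) h]

/-- The weighted form of Petridis' lemma: some positive-measure `Y ⊆ B` is such
that every `C • Y` has weighted expansion at most `l`, as `B` has. -/
theorem exists_subset_sum_measureReal_smul_le
    (hact : ∀ g : G, MeasurePreserving (fun x : X => g • x) μ μ) {ι : Type*} [Fintype ι]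
    (A : ι → Set G) (w : ι → ℝ) (hw : ∀ i, 0 ≤ w i) (l : ℝ) (hl : 0 ≤ l) {B : Set X}
    (hB : MeasurableSet B) (hBl : ∑ i, w i * μ.real (A i • B) < l * μ.real B) :
    ∃ Y ⊆ B, MeasurableSet Y ∧ 0 < μ Y ∧
      ∀ C : Set G, ∑ i, w i * μ.real (A i • C • Y) ≤ l * μ.real (C • Y) := by
  set φ : Set X → ℝ := fun S => ∑ i, w i * μ.real (A i • S) with hφ
  have hpos : ∀ S, 0 ≤ φ S := fun S => Finset.sum_nonneg fun i _ =>
    mul_nonneg (hw i) measureReal_nonneg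
  have hmono : Monotone φ := fun S T h => Finset.sum_le_sum fun i _ =>
    mul_le_mul_of_nonneg_left (measureReal_mono (Set.smul_subset_smul_left h)) (hw i)
  have hsub : ∀ S T, MeasurableSet S → MeasurableSet T →
      φ (S ∪ T) + φ (S ∩ T) ≤ φ S + φ T := by
    intro S T _ hT
    simp only [hφ, ← Finset.sum_add_distrib, ← mul_add]
    exact Finset.sum_le_sum fun i _ => mul_le_mul_of_nonneg_left
      (measureReal_set_smul_submodular hact (A i) hT) (hw i)
  have hcont : ∀ s : ℕ → Set X, Monotone s → (∀ n, MeasurableSet (s n)) →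
      Tendsto (fun n => φ (s n)) atTop (𝓝 (φ (⋃ n, s n))) := fun s hs _ =>
    tendsto_finsetSum _ fun i _ => (tendsto_measureReal_set_smul_iUnion (A i) hs).const_mul _
  obtain ⟨Y, hYB, hY, hmin⟩ := exists_minimizer_of_submodular μ φ hpos hmono hsub hcont l hl B
  refine ⟨Y, hYB, hY, ?_, ?_⟩
  · by_contra h0
    have h1 : μ.real Y = 0 := by
      rw [measureReal_def, nonpos_iff_eq_zero.mp (not_lt.mp h0), ENNReal.toReal_zero]
    have h2 := hmin B subset_rfl hB
    have h3 := hpos Y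
    simp only [hφ] at h2 h3
    rw [h1] at h2
    linarith
  have hCm : ∀ C : Set G, MeasurableSet (C • Y) := fun C =>
    measurableSet_set_smul_of_measurePreserving hact C hY
  have hfin : ∀ C : Finset G, φ ((C : Set G) • Y) ≤ l * μ.real ((C : Set G) • Y) := by
    classical
    intro C
    induction C using Finset.induction_on with
    | empty => simp [hφ]
    | insert g C _ ih =>
      have hU : ((insert g C : Finset G) : Set G) • Y = (C : Set G) • Y ∪ g • Y := by
        rw [Finset.coe_insert, Set.insert_eq, Set.union_smul, Set.singleton_smul, Set.union_comm]
      -- The overlap of `C • Y` and `g • Y`, translated back into `Y`, competes with `Y` in the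
      -- minimization.
      set Z : Set X := g⁻¹ • ((C : Set G) • Y) ∩ Y with hZ
      have hZm : MeasurableSet Z :=
        (measurableSet_smul_set_of_measurePreserving hact _ (hCm _)).inter hY
      have hI : (C : Set G) • Y ∩ g • Y = g • Z := by
        rw [hZ, Set.smul_set_inter, smul_inv_smul]
      have hgm := measurableSet_smul_set_of_measurePreserving hact g hY
      have h1 := hsub _ _ (hCm (C : Set G)) hgm
      have h2 : μ.real ((C : Set G) • Y ∪ g • Y) + μ.real ((C : Set G) • Y ∩ g • Y) =
          μ.real ((C : Set G) • Y) + μ.real (g • Y) := measureReal_union_add_inter hgm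
      have h3 := hmin Z (Set.inter_subset_right.trans hYB) hZm
      have h4 : ∀ S, MeasurableSet S → φ (g • S) = φ S := fun S hS =>
        Finset.sum_congr rfl fun i _ => by rw [measureReal_set_smul_smul_set hact (A i) g hS]
      have h5 : ∀ S, MeasurableSet S → μ.real (g • S) = μ.real S := fun S hS => by
        rw [measureReal_def, measure_smul_set_of_measurePreserving hact g hS, measureReal_def]
      rw [hI, h4 Z hZm, h4 Y hY] at h1
      rw [hI, h5 Z hZm, h5 Y hY] at h2
      rw [hU]
      have h6 : l * μ.real ((C : Set G) • Y ∪ g • Y) =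
          l * μ.real ((C : Set G) • Y) + l * μ.real Y - l * μ.real Z := by
        rw [← mul_add, ← mul_sub, ← h2, add_sub_cancel_right]
      linarith
  intro C
  obtain ⟨e, he⟩ := exists_injective_nat G
  set D : ℕ → Set G := fun n => {g ∈ C | e g ≤ n} with hD
  have hDf : ∀ n, (D n).Finite := fun n =>
    ((Set.finite_Iic n).preimage he.injOn).subset fun g hg => hg.2
  have hDU : (⋃ n, D n • Y) = C • Y := by
    rw [← Set.iUnion_smul]
    congr 1
    ext g
    simp only [hD, Set.mem_iUnion, Set.mem_ofPred_eq]
    exact ⟨fun ⟨_, h, _⟩ => h, fun h => ⟨e g, h, le_rfl⟩⟩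
  have hDmono : Monotone fun n => D n • Y := fun i j h =>
    Set.smul_subset_smul_right fun g hg => ⟨hg.1, hg.2.trans h⟩
  have t1 := hcont _ hDmono fun n => hCm _
  have t2 : Tendsto (fun n => μ.real (D n • Y)) atTop (𝓝 (μ.real (⋃ n, D n • Y))) :=
    (ENNReal.tendsto_toReal (measure_ne_top _ _)).comp (tendsto_measure_iUnion_atTop hDmono)
  rw [hDU] at t1 t2
  refine le_of_tendsto_of_tendsto' t1 (t2.const_mul l) fun n => ?_
  have := hfin (hDf n).toFinset
  rwa [Set.Finite.coe_toFinset] at this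

end Translates

/-- The Plünnecke inequality up to a constant depending only on the number of summands. -/
theorem exists_subset_measureReal_prod_smul_le {G X : Type*} [CommGroup G] [Countable G]
    [MulAction G X] [MeasurableSpace X] {μ : Measure X} [IsFiniteMeasure μ]
    (hact : ∀ g : G, MeasurePreserving (fun x : X => g • x) μ μ) {ι : Type*} [Fintype ι]
    (A : ι → Set G) {B : Set X} (hB : MeasurableSet B) (hB0 : μ B ≠ 0) :
    ∃ Y ⊆ B, MeasurableSet Y ∧ 0 < μ Y ∧
      μ.real ((∏ i, A i) • Y) ≤ ((Fintype.card ι : ℝ) + 1) ^ Fintype.card ι *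
        (∏ i, μ.real (A i • B) / μ.real B) * μ.real Y := by
  classical
  have hBpos : 0 < μ.real B := ENNReal.toReal_pos hB0 (measure_ne_top _ _)
  set α : ι → ℝ := fun i => μ.real (A i • B) / μ.real B with hα
  set l : ℝ := (Fintype.card ι : ℝ) + 1 with hl
  have hl0 : 0 ≤ l := by positivity
  have hα0 : ∀ i, 0 ≤ α i := fun i => by positivity
  -- The weights make each term at most `μ.real B`; the extra `1` in `l` makes the inequality
  -- strict.
  have hsum : ∑ i, (α i)⁻¹ * μ.real (A i • B) < l * μ.real B := by
    calc ∑ i, (α i)⁻¹ * μ.real (A i • B) ≤ ∑ _i : ι, μ.real B := by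
          refine Finset.sum_le_sum fun i _ => ?_
          have h1 : μ.real (A i • B) = α i * μ.real B := by
            simp only [hα]; field_simp
          rw [h1, ← mul_assoc]
          exact mul_le_of_le_one_left hBpos.le inv_mul_le_one
      _ = Fintype.card ι * μ.real B := by simp
      _ < l * μ.real B := by rw [hl]; linarith
  obtain ⟨Y, hYB, hY, hY0, h⟩ := exists_subset_sum_measureReal_smul_le hact A
    (fun i => (α i)⁻¹) (fun i => inv_nonneg.mpr (hα0 i)) l hl0 hB hsum
  refine ⟨Y, hYB, hY, hY0, ?_⟩
  have hstep : ∀ i (C : Set G), μ.real (A i • C • Y) ≤ l * α i * μ.real (C • Y) := by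
    intro i C
    -- If `α i = 0`, its weight is `0⁻¹ = 0` and `h` says nothing, but then `A i` is empty.
    rcases (hα0 i).eq_or_lt with h0 | h0
    · have hA : A i = ∅ := by
        by_contra hne
        obtain ⟨g, hg⟩ := Set.nonempty_iff_ne_empty.mpr hne
        have h1 : μ.real (g • B) ≤ μ.real (A i • B) :=
          measureReal_mono (Set.smul_set_subset_smul hg)
        rw [measureReal_def, measure_smul_set_of_measurePreserving hact g hB,
          ← measureReal_def] at h1
        have h2 : 0 < α i := div_pos (hBpos.trans_le h1) hBpos
        exact h2.ne h0
      rw [hA, Set.empty_smul, measureReal_empty, ← h0]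
      simp
    · have h1 : (α i)⁻¹ * μ.real (A i • C • Y) ≤ l * μ.real (C • Y) :=
        (Finset.single_le_sum (f := fun j => (α j)⁻¹ * μ.real (A j • C • Y))
          (fun j _ => mul_nonneg (inv_nonneg.mpr (hα0 j)) measureReal_nonneg)
          (Finset.mem_univ i)).trans (h C)
      rw [inv_mul_le_iff₀ h0] at h1
      linarith
  have hind : ∀ s : Finset ι, μ.real ((∏ i ∈ s, A i) • Y) ≤ (∏ i ∈ s, l * α i) * μ.real Y := by
    intro s
    induction s using Finset.induction_on with
    | empty => simp
    | insert i s hi ih =>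
      rw [Finset.prod_insert hi, Finset.prod_insert hi, mul_smul, mul_assoc]
      exact (hstep i _).trans (mul_le_mul_of_nonneg_left ih (mul_nonneg hl0 (hα0 i)))
  have := hind Finset.univ
  rwa [Finset.prod_mul_distrib, Finset.prod_const, Finset.card_univ] at this

/-! ### Product actions and tensor powers. -/

/-- The coordinatewise action of a product of monoids on a product. -/
@[reducible]
def prodCoordinateMulAction (G H X Y : Type*) [Monoid G] [Monoid H] [MulAction G X]
    [MulAction H Y] : MulAction (G × H) (X × Y) where
  smul g p := (g.1 • p.1, g.2 • p.2)
  one_smul p := Prod.ext (one_smul G p.1) (one_smul H p.2)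
  mul_smul g h p := Prod.ext (mul_smul g.1 h.1 p.1) (mul_smul g.2 h.2 p.2)

section Product

variable {G H X Y : Type*} [CommGroup G] [CommGroup H] [MulAction G X] [MulAction H Y]

attribute [local instance] prodCoordinateMulAction

theorem prod_smul_mk (g : G) (h : H) (x : X) (y : Y) : (g, h) • (x, y) = (g • x, h • y) := rfl

theorem Set.prod_smul_prod (A : Set G) (C : Set H) (S : Set X) (T : Set Y) :
    (A ×ˢ C) • (S ×ˢ T) = (A • S) ×ˢ (C • T) := by
  ext ⟨x, y⟩
  simp only [Set.mem_smul, Set.mem_prod, Prod.exists, prod_smul_mk, Prod.mk.injEq]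
  constructor
  · rintro ⟨g, h, ⟨hg, hh⟩, s, t, ⟨hs, ht⟩, rfl, rfl⟩
    exact ⟨⟨g, hg, s, hs, rfl⟩, h, hh, t, ht, rfl⟩
  · rintro ⟨⟨g, hg, s, hs, rfl⟩, h, hh, t, ht, rfl⟩
    exact ⟨g, h, ⟨hg, hh⟩, s, t, ⟨hs, ht⟩, rfl, rfl⟩

theorem Set.mk_preimage_one_prod_smul (C : Set H) (S : Set (X × Y)) (x : X) :
    Prod.mk x ⁻¹' (({1} : Set G) ×ˢ C • S) = C • (Prod.mk x ⁻¹' S) := by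
  ext y
  simp only [Set.mem_smul, Set.mem_prod, Prod.exists, prod_smul_mk, Prod.mk.injEq,
    Set.mem_preimage, Set.mem_singleton_iff]
  constructor
  · rintro ⟨g, h, ⟨rfl, hh⟩, s, t, hst, hs, rfl⟩
    rw [one_smul] at hs
    exact ⟨h, hh, t, hs ▸ hst, rfl⟩
  · rintro ⟨h, hh, t, ht, rfl⟩
    exact ⟨1, h, ⟨rfl, hh⟩, x, t, ht, one_smul _ _, rfl⟩

theorem Set.mk_preimage_prod_one_smul (A : Set G) (S : Set (X × Y)) (y : Y) :
    (fun x => (x, y)) ⁻¹' (A ×ˢ ({1} : Set H) • S) = A • ((fun x => (x, y)) ⁻¹' S) := by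
  ext x
  simp only [Set.mem_smul, Set.mem_prod, Prod.exists, prod_smul_mk, Prod.mk.injEq,
    Set.mem_preimage, Set.mem_singleton_iff]
  constructor
  · rintro ⟨g, h, ⟨hg, rfl⟩, s, t, hst, rfl, ht⟩
    rw [one_smul] at ht
    exact ⟨g, hg, s, ht ▸ hst, rfl⟩
  · rintro ⟨g, hg, s, hs, rfl⟩
    exact ⟨g, 1, ⟨hg, rfl⟩, s, y, hs, rfl, one_smul _ _⟩

variable [MeasurableSpace X] [MeasurableSpace Y] {μ : Measure X} {ν : Measure Y}
  [IsFiniteMeasure μ] [IsFiniteMeasure ν]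

theorem measurePreserving_prod_smul
    (hG : ∀ g : G, MeasurePreserving (fun x : X => g • x) μ μ)
    (hH : ∀ h : H, MeasurePreserving (fun y : Y => h • y) ν ν) (p : G × H) :
    MeasurePreserving (fun z : X × Y => p • z) (μ.prod ν) (μ.prod ν) :=
  (hG p.1).prod (hH p.2)

theorem Set.finset_prod_prod_self {ι : Type*} (A : ι → Set G) (s : Finset ι) :
    ∏ i ∈ s, A i ×ˢ A i = (∏ i ∈ s, A i) ×ˢ (∏ i ∈ s, A i) := by
  classical
  induction s using Finset.induction_on with
  | empty =>
    ext ⟨a, b⟩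
    simp [Prod.ext_iff]
  | insert i s hi ih =>
    rw [Finset.prod_insert hi, Finset.prod_insert hi, ih, Set.prod_mul_prod_comm]

/-- Expansion lower bounds multiply under products. -/
theorem mul_measure_le_measure_prod_smul [Countable G] [Countable H]
    (hG : ∀ g : G, MeasurePreserving (fun x : X => g • x) μ μ)
    (hH : ∀ h : H, MeasurePreserving (fun y : Y => h • y) ν ν)
    {A : Set G} {C : Set H} {B : Set X} {D : Set Y} {a c : ℝ≥0∞}
    (ha : ∀ S ⊆ B, MeasurableSet S → a * μ S ≤ μ (A • S))
    (hc : ∀ T ⊆ D, MeasurableSet T → c * ν T ≤ ν (C • T))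
    {S : Set (X × Y)} (hSB : S ⊆ B ×ˢ D) (hS : MeasurableSet S) :
    a * c * (μ.prod ν) S ≤ (μ.prod ν) ((A ×ˢ C) • S) := by
  have hact := measurePreserving_prod_smul hG hH
  have hm : MeasurableSet (({1} : Set G) ×ˢ C • S) :=
    measurableSet_set_smul_of_measurePreserving hact _ hS
  -- Expanding one coordinate at a time reduces the bound to slices, integrated by Tonelli.
  have hsplit : (A ×ˢ C) • S = A ×ˢ ({1} : Set H) • ({1} : Set G) ×ˢ C • S := by
    rw [smul_smul, Set.prod_mul_prod_comm, Set.singleton_one, Set.singleton_one, mul_one, one_mul]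
  have h1 : c * (μ.prod ν) S ≤ (μ.prod ν) (({1} : Set G) ×ˢ C • S) := by
    rw [Measure.prod_apply hS, Measure.prod_apply hm,
      ← lintegral_const_mul _ (measurable_measure_prodMk_left hS)]
    refine lintegral_mono fun x => ?_
    rw [Set.mk_preimage_one_prod_smul]
    exact hc _ (fun y hy => (hSB hy).2) (measurable_prodMk_left hS)
  have h2 : a * (μ.prod ν) (({1} : Set G) ×ˢ C • S) ≤ (μ.prod ν) ((A ×ˢ C) • S) := by
    have hm2 := measurableSet_set_smul_of_measurePreserving hact (A ×ˢ C) hS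
    rw [Measure.prod_apply_symm hm, Measure.prod_apply_symm hm2,
      ← lintegral_const_mul _ (measurable_measure_prodMk_right hm)]
    refine lintegral_mono fun y => ?_
    rw [hsplit, Set.mk_preimage_prod_one_smul]
    refine ha _ ?_ (measurable_prodMk_right hm)
    rintro x ⟨⟨g, h⟩, ⟨hg, -⟩, ⟨s, t⟩, hst, he⟩
    have hx : g • s = x := congrArg Prod.fst he
    rw [show g = 1 from hg, one_smul] at hx
    exact hx ▸ (hSB hst).1
  calc a * c * (μ.prod ν) S = a * (c * (μ.prod ν) S) := mul_assoc _ _ _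
    _ ≤ a * (μ.prod ν) (({1} : Set G) ×ˢ C • S) := by gcongr
    _ ≤ _ := h2

end Product

attribute [local instance] prodCoordinateMulAction in
/-- The tensor power argument. -/
theorem pow_two_pow_le_of_forall_mul_measure_le {ι : Type*} [Fintype ι] (n : ℕ) :
    ∀ {G X : Type*} [CommGroup G] [Countable G] [MulAction G X] [MeasurableSpace X]
      (μ : Measure X) [IsFiniteMeasure μ]
      (_ : ∀ g : G, MeasurePreserving (fun x : X => g • x) μ μ)
      (A : ι → Set G) {B : Set X} (_ : MeasurableSet B) (_ : μ B ≠ 0) (c : NNReal)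
      (_ : ∀ Y ⊆ B, MeasurableSet Y → c * μ Y ≤ μ ((∏ i, A i) • Y)),
      (c : ℝ) ^ 2 ^ n ≤ ((Fintype.card ι : ℝ) + 1) ^ Fintype.card ι *
        (∏ i, μ.real (A i • B) / μ.real B) ^ 2 ^ n := by
  induction n with
  | zero =>
    intro G X _ _ _ _ μ _ hact A B hB hB0 c hc
    obtain ⟨Y, hYB, hY, hY0, h⟩ := exists_subset_measureReal_prod_smul_le hact A hB hB0
    have hYpos : 0 < μ.real Y := ENNReal.toReal_pos hY0.ne' (measure_ne_top _ _)
    have h1 := ENNReal.toReal_mono (measure_ne_top _ _) (hc Y hYB hY)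
    rw [ENNReal.toReal_mul, ENNReal.coe_toReal, ← measureReal_def, ← measureReal_def] at h1
    rw [pow_zero, pow_one, pow_one]
    exact le_of_mul_le_mul_right (h1.trans h) hYpos
  | succ n ih =>
    intro G X _ _ _ _ μ _ hact A B hB hB0 c hc
    have hBB : (μ.prod μ) (B ×ˢ B) ≠ 0 := by
      rw [Measure.prod_prod]
      exact mul_ne_zero hB0 hB0
    -- Squaring the system squares `c` and every ratio, but keeps `ι` and hence the constant.
    have h := ih (μ.prod μ) (measurePreserving_prod_smul hact hact) (fun i => A i ×ˢ A i)
      (hB.prod hB) hBB (c * c) fun Y hY hYm => by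
        rw [Set.finset_prod_prod_self, ENNReal.coe_mul]
        exact mul_measure_le_measure_prod_smul hact hact hc hc hY hYm
    have hα : ∀ i, (μ.prod μ).real ((A i ×ˢ A i) • (B ×ˢ B)) / (μ.prod μ).real (B ×ˢ B) =
        (μ.real (A i • B) / μ.real B) ^ 2 := fun i => by
      rw [Set.prod_smul_prod, measureReal_prod_prod, measureReal_prod_prod, mul_div_mul_comm, sq]
    simp only [hα] at h
    rw [Finset.prod_pow, ← pow_mul, ← pow_succ', NNReal.coe_mul, ← sq, ← pow_mul, ← pow_succ'] at h
    exact h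

theorem le_of_forall_pow_two_pow_le {c r D : ℝ} (hr : 0 ≤ r)
    (h : ∀ n : ℕ, c ^ 2 ^ n ≤ D * r ^ 2 ^ n) : c ≤ r := by
  by_contra! hlt
  rcases hr.eq_or_lt with rfl | hr
  · have := h 0
    simp only [pow_zero, pow_one, mul_zero] at this
    linarith
  · have h1 : 1 < c / r := (one_lt_div hr).mpr hlt
    obtain ⟨n, hn⟩ := pow_unbounded_of_one_lt D h1
    have h2 : D < (c / r) ^ 2 ^ n :=
      hn.trans_le (pow_le_pow_right₀ h1.le n.lt_two_pow_self.le)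
    rw [div_pow, lt_div_iff₀ (by positivity)] at h2
    exact (h n).not_gt h2

theorem mainTheorem7 {G X : Type*} [CommGroup G] [Countable G] [MulAction G X]
    [MeasurableSpace X] (μ : Measure X) [IsProbabilityMeasure μ]
    (hact : ∀ g : G, MeasurePreserving (fun x : X => g • x) μ μ)
    (k : ℕ) (A : Fin k → Set G) (B : Set X) (hB : MeasurableSet B) (hB0 : μ B ≠ 0) :
    magnificationRatio μ (∏ i, A i) B ≤ ∏ i, (μ (A i • B) / μ B) := by
  have hle : ∀ Y ⊆ B, MeasurableSet Y → 0 < μ Y →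
      magnificationRatio μ (∏ i, A i) B ≤ μ ((∏ i, A i) • Y) / μ Y := fun Y h1 h2 h3 =>
    sInf_le ⟨Y, h1, h2, h3, rfl⟩
  have htop : magnificationRatio μ (∏ i, A i) B ≠ ∞ :=
    ne_top_of_le_ne_top (ENNReal.div_ne_top (measure_ne_top _ _) hB0)
      (hle B subset_rfl hB (pos_iff_ne_zero.mpr hB0))
  lift magnificationRatio μ (∏ i, A i) B to NNReal using htop with c
  have hc : ∀ Y ⊆ B, MeasurableSet Y → c * μ Y ≤ μ ((∏ i, A i) • Y) := by
    intro Y hYB hY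
    rcases eq_or_ne (μ Y) 0 with h0 | h0
    · simp [h0]
    · exact (ENNReal.le_div_iff_mul_le (Or.inl h0) (Or.inl (measure_ne_top _ _))).mp
        (hle Y hYB hY (pos_iff_ne_zero.mpr h0))
  have hr : 0 ≤ ∏ i, μ.real (A i • B) / μ.real B :=
    Finset.prod_nonneg fun i _ => by positivity
  have h := le_of_forall_pow_two_pow_le hr fun n =>
    pow_two_pow_le_of_forall_mul_measure_le n μ hact A hB hB0 c hc
  have htop' : ∏ i, (μ (A i • B) / μ B) ≠ ∞ :=
    ENNReal.prod_ne_top fun i _ => ENNReal.div_ne_top (measure_ne_top _ _) hB0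
  rw [← ENNReal.toReal_le_toReal ENNReal.coe_ne_top htop', ENNReal.coe_toReal, ENNReal.toReal_prod]
  simpa only [ENNReal.toReal_div, ← measureReal_def] using h
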